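/- Let $\mathbb F$ be an algebraically closed field of characteristic $0$ and let $\mathbb I=\{0,1,2,3\}$. The tetrahedron algebra $\boxtimes$ is the Lie algebra over $\mathbb F$ with generators $x_{ij}$ ($i,j\in\mathbb I$, $i\ne j$) and relations (i) $x_{ij}+x_{ji}=0$ for distinct $i,j$; (ii) $[x_{ij},x_{jk}]=2x_{ij}+2x_{jk}$ for mutually distinct $i,j,k$; (iii) $[x_{ij},[x_{ij},[x_{ij},x_{k\ell}]]]=4[x_{ij},x_{k\ell}]$ for mutually distinct $i,j,k,\ell$. *Evaluation modules.* Let $e,f,h$ be the basis of $\mathfrak{sl}_2=\mathfrak{sl}_2(\mathbb F)$ with $[h,e]=2e$, $[h,f]=-2f$, $[e,f]=h$, and put $x=2e-h$, $y=-2f-h$, $z=h$. For $a\in\mathbb F\setminus\{0,1\}$ let $EV_a:\boxtimes\to\mathfrak{sl}_2$ be the Lie algebra homomorphism with $$x_{12}\mapsto x,\qquad x_{23}\mapsto y,\qquad x_{31}\mapsto z,$$ $$x_{03}\mapsto ay+(a-1)z,\qquad x_{01}\mapsto (1-a^{-1})z-a^{-1}x,\qquad x_{02}\mapsto (1-a)^{-1}x+a(1-a)^{-1}y.$$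 For an integer $d\ge 0$ let $V_d$ be the irreducible $\mathfrak{sl}_2$-module with basis $v_0,\dots,v_d$ such that $h.v_n=(d-2n)v_n$, $f.v_n=(n+1)v_{n+1}$ and $e.v_n=(d-n+1)v_{n-1}$, where $v_{-1}=v_{d+1}=0$. An evaluation module for $\boxtimes$ is a module $V_d(a)$ obtained by pulling back $V_d$ along $EV_a$, where $d\ge1$ is an integer and $a\in\mathbb F\setminus\{0,1\}$. *Shape.* If $V$ is a finite-dimensional irreducible $\boxtimes$-module, there is a unique integer $d\ge0$, the diameter of $V$, such that for every generator $x_{ij}$ the set of distinct eigenvalues of $x_{ij}$ on $V$ is $\{d-2n\mid 0\le n\le d\}$. For distinct $i,j\in\mathbb I$ and $0\le n\le d$ let $\rho_n$ be the dimension of the eigenspace of $x_{ij}$ on $V$ for the eigenvalue $2n-d$. The sequence $(\rho_0,\dots,\rho_d)$ does not depend on the choice of $i,j$ and is called the shape of $V$. **Proposition.** Let $V$ be a finite-dimensional irreducible $\boxtimes$-module that is nontrivial (that is, $\boxtimes$ does not act on $V$ as zero). Then the following are equivalent: (i) $V$ is isomorphic to an evaluation module for $\boxtimes$; (ii) $V$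 has shape $(1,1,\dots,1)$, where the shape may be computed from any one pair of distinct $i,j\in\mathbb I$. -/

import Mathlib

open LieAlgebra.SpecialLinear

namespace Tetrahedron

noncomputable section

/-! ### The tetrahedron algebra -/

section TetrahedronAlgebra

variable (F : Type*) [Field F]

/-- Index set of the generators: ordered pairs of distinct vertices of the tetrahedron. -/
abbrev Edge : Type := {p : Fin 4 × Fin 4 // p.1 ≠ p.2}

/-- The free generator attached to the ordered pair `(i, j)`, `i ≠ j`. -/
def freeGen (i j : Fin 4) (h : i ≠ j) : FreeLieAlgebra F Edge :=
  FreeLieAlgebra.of F ⟨(i, j), h⟩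

/-- The elements of the free Lie algebra that are set equal to zero in the tetrahedron algebra. -/
inductive IsRelator : FreeLieAlgebra F Edge → Prop
  | skew (i j : Fin 4) (hij : i ≠ j) :
      IsRelator (freeGen F i j hij + freeGen F j i hij.symm)
  | triangle (i j k : Fin 4) (hij : i ≠ j) (hjk : j ≠ k) (_hik : i ≠ k) :
      IsRelator (⁅freeGen F i j hij, freeGen F j k hjk⁆
        - ((2 : F) • freeGen F i j hij + (2 : F) • freeGen F j k hjk))
  | dolanGrady (i j k l : Fin 4) (hij : i ≠ j) (_hik : i ≠ k) (_hil : i ≠ l)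
      (_hjk : j ≠ k) (_hjl : j ≠ l) (hkl : k ≠ l) :
      IsRelator (⁅freeGen F i j hij, ⁅freeGen F i j hij, ⁅freeGen F i j hij, freeGen F k l hkl⁆⁆⁆
        - (4 : F) • ⁅freeGen F i j hij, freeGen F k l hkl⁆)

/-- The Lie ideal generated by the relators. -/
def relIdeal : LieIdeal F (FreeLieAlgebra F Edge) :=
  LieSubmodule.lieSpan F (FreeLieAlgebra F Edge) {r | IsRelator F r}

/-- The tetrahedron algebra `⊠` over `F`. -/
abbrev Tet : Type _ := FreeLieAlgebra F Edge ⧸ relIdeal F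

/-- The generator `x_{ij}` of `⊠`, for distinct `i`, `j`. -/
def tetGen (i j : Fin 4) (h : i ≠ j) : Tet F :=
  LieSubmodule.Quotient.mk (freeGen F i j h)

variable {F}

/-- A homomorphism from the free Lie algebra that kills the relators induces one from `⊠`. -/
def tetLift {L : Type*} [LieRing L] [LieAlgebra F L] (g : FreeLieAlgebra F Edge →ₗ⁅F⁆ L)
    (hg : ∀ r, IsRelator F r → g r = 0) : Tet F →ₗ⁅F⁆ L :=
  have hle : relIdeal F ≤ g.ker :=
    LieSubmodule.lieSpan_le.2 fun r hr => LieHom.mem_ker.2 (hg r hr)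
  { (relIdeal F).toSubmodule.liftQ (g : FreeLieAlgebra F Edge →ₗ[F] L)
      (fun r hr => LieHom.mem_ker.1 (hle hr)) with
    map_lie' := by
      intro a b
      obtain ⟨a, rfl⟩ := LieSubmodule.Quotient.surjective_mk' _ a
      obtain ⟨b, rfl⟩ := LieSubmodule.Quotient.surjective_mk' _ b
      exact g.map_lie a b }

end TetrahedronAlgebra

/-! ### The Lie algebra `sl₂` and the evaluation homomorphism -/

section Evaluation

variable (F : Type*) [Field F]

/-- `e` in the standard basis `e, f, h` of `sl₂`. -/
def slE : sl (Fin 2) F := ⟨!![0, 1; 0, 0], by simp [sl, Matrix.trace_fin_two]⟩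

/-- `f` in the standard basis `e, f, h` of `sl₂`. -/
def slF : sl (Fin 2) F := ⟨!![0, 0; 1, 0], by simp [sl, Matrix.trace_fin_two]⟩

/-- `h` in the standard basis `e, f, h` of `sl₂`. -/
def slH : sl (Fin 2) F := ⟨!![1, 0; 0, -1], by simp [sl, Matrix.trace_fin_two]⟩

/-- `x` in the equitable basis `x, y, z` of `sl₂`. -/
def eqX : sl (Fin 2) F := (2 : F) • slE F - slH F

/-- `y` in the equitable basis `x, y, z` of `sl₂`. -/
def eqY : sl (Fin 2) F := -((2 : F) • slF F) - slH F

/-- `z` in the equitable basis `x, y, z` of `sl₂`. -/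
def eqZ : sl (Fin 2) F := slH F

variable {F}

/-- The images of the generators `x_{ij}` under the evaluation homomorphism at `a`. They are
obtained by putting `t = a` in the formulas for the isomorphism from `⊠` to the three-point loop
algebra `sl₂ ⊗ F[t, t⁻¹, (t-1)⁻¹]`. -/
def evGen (a : F) : Fin 4 → Fin 4 → sl (Fin 2) F
  | 1, 2 => eqX F
  | 2, 1 => -eqX F
  | 2, 3 => eqY F
  | 3, 2 => -eqY F
  | 3, 1 => eqZ F
  | 1, 3 => -eqZ F
  | 0, 3 => a • eqY F + (a - 1) • eqZ F
  | 3, 0 => -(a • eqY F + (a - 1) • eqZ F)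
  | 0, 1 => (1 - a⁻¹) • eqZ F - a⁻¹ • eqX F
  | 1, 0 => -((1 - a⁻¹) • eqZ F - a⁻¹ • eqX F)
  | 0, 2 => (1 - a)⁻¹ • eqX F + (a * (1 - a)⁻¹) • eqY F
  | 2, 0 => -((1 - a)⁻¹ • eqX F + (a * (1 - a)⁻¹) • eqY F)
  | _, _ => 0

theorem evGen_skew (a : F) (i j : Fin 4) : evGen a i j + evGen a j i = 0 := by
  fin_cases i <;> fin_cases j <;> simp [evGen]

theorem val_eqX : (eqX F).val = !![-1, 2; 0, 1] := by
  change (2 : F) • !![(0 : F), 1; 0, 0] - !![(1 : F), 0; 0, -1] = _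
  ext p q
  fin_cases p <;> fin_cases q <;> simp

theorem val_eqY : (eqY F).val = !![-1, 0; -2, 1] := by
  change -((2 : F) • !![(0 : F), 0; 1, 0]) - !![(1 : F), 0; 0, -1] = _
  ext p q
  fin_cases p <;> fin_cases q <;> simp

theorem val_eqZ : (eqZ F).val = !![1, 0; 0, -1] := rfl

theorem val_smul (c : F) (M : sl (Fin 2) F) : (c • M).val = c • M.val := rfl

theorem val_add (M N : sl (Fin 2) F) : (M + N).val = M.val + N.val := rfl

theorem val_sub (M N : sl (Fin 2) F) : (M - N).val = M.val - N.val := rfl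

theorem val_neg (M : sl (Fin 2) F) : (-M).val = -M.val := rfl

set_option maxHeartbeats 2000000 in
theorem evGen_triangle (a : F) (h0 : a ≠ 0) (h1 : a ≠ 1) (i j k : Fin 4)
    (hij : i ≠ j) (hjk : j ≠ k) (hik : i ≠ k) :
    ⁅evGen a i j, evGen a j k⁆ = (2 : F) • evGen a i j + (2 : F) • evGen a j k := by
  have h1' : (1 - a) ≠ 0 := sub_ne_zero.2 h1.symm
  obtain ⟨b, hb⟩ : ∃ b, a⁻¹ = b := ⟨_, rfl⟩
  obtain ⟨c, hc⟩ : ∃ c, (1 - a)⁻¹ = c := ⟨_, rfl⟩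
  have hb' : a * b = 1 := by rw [← hb]; exact mul_inv_cancel₀ h0
  have hc' : (1 - a) * c = 1 := by rw [← hc]; exact mul_inv_cancel₀ h1'
  apply Subtype.ext
  fin_cases i <;> fin_cases j <;> first | exact absurd rfl hij | skip
  all_goals (fin_cases k <;> first | exact absurd rfl hjk | exact absurd rfl hik | skip)
  all_goals
    simp only [evGen, sl_bracket, hb, hc, Fin.zero_eta, Fin.mk_one, Fin.reduceFinMk]
    repeat first
      | simp only [val_neg]
      | simp only [val_add, val_sub]
      | simp only [val_smul]
      | simp only [val_eqX, val_eqY, val_eqZ]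
    ext p q
    fin_cases p <;> fin_cases q <;> simp <;> grind

theorem evGen_sq (a : F) (h0 : a ≠ 0) (h1 : a ≠ 1) (i j : Fin 4) (hij : i ≠ j) :
    (evGen a i j).val * (evGen a i j).val = 1 := by
  have h1' : (1 - a) ≠ 0 := sub_ne_zero.2 h1.symm
  obtain ⟨b, hb⟩ : ∃ b, a⁻¹ = b := ⟨_, rfl⟩
  obtain ⟨c, hc⟩ : ∃ c, (1 - a)⁻¹ = c := ⟨_, rfl⟩
  have hb' : a * b = 1 := by rw [← hb]; exact mul_inv_cancel₀ h0
  have hc' : (1 - a) * c = 1 := by rw [← hc]; exact mul_inv_cancel₀ h1'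
  fin_cases i <;> fin_cases j <;> first | exact absurd rfl hij | skip
  all_goals
    simp only [evGen, hb, hc, Fin.zero_eta, Fin.mk_one, Fin.reduceFinMk]
    repeat first
      | simp only [val_neg]
      | simp only [val_add, val_sub]
      | simp only [val_smul]
      | simp only [val_eqX, val_eqY, val_eqZ]
    ext p q
    fin_cases p <;> fin_cases q <;> simp <;> grind

theorem evGen_dolanGrady (a : F) (h0 : a ≠ 0) (h1 : a ≠ 1) (i j : Fin 4) (hij : i ≠ j)
    (Y : sl (Fin 2) F) :
    ⁅evGen a i j, ⁅evGen a i j, ⁅evGen a i j, Y⁆⁆⁆ = (4 : F) • ⁅evGen a i j, Y⁆ := by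
  apply Subtype.ext
  have hs := evGen_sq a h0 h1 i j hij
  simp only [sl_bracket, val_smul]
  generalize (evGen a i j).val = X at hs
  generalize Y.val = Z
  have h4 : (4 : F) • (X * Z - Z * X) = 4 * (X * Z - Z * X) := by
    rw [ofNat_smul_eq_nsmul, nsmul_eq_mul, Nat.cast_ofNat]
  rw [h4]
  have e1 : X * (X * (X * Z - Z * X) - (X * Z - Z * X) * X)
      - (X * (X * Z - Z * X) - (X * Z - Z * X) * X) * X
      = X * X * (X * Z) - 3 * (X * X) * Z * X + 3 * X * Z * (X * X) - Z * X * (X * X) := by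
    noncomm_ring
  rw [e1, hs]
  noncomm_ring

/-- The evaluation homomorphism `EV_a : ⊠ → sl₂`, for `a ≠ 0, 1`. -/
def EV (a : F) (h0 : a ≠ 0) (h1 : a ≠ 1) : Tet F →ₗ⁅F⁆ sl (Fin 2) F :=
  tetLift (FreeLieAlgebra.lift F fun p : Edge => evGen a p.1.1 p.1.2) <| by
    intro r hr
    cases hr with
    | skew i j hij =>
      simpa [freeGen] using evGen_skew a i j
    | triangle i j k hij hjk hik =>
      simpa [freeGen, sub_eq_zero] using evGen_triangle a h0 h1 i j k hij hjk hik
    | dolanGrady i j k l hij hik hil hjk hjl hkl =>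
      simpa [freeGen, sub_eq_zero] using evGen_dolanGrady a h0 h1 i j hij (evGen a k l)

end Evaluation

/-! ### The irreducible `sl₂`-modules and the evaluation modules -/

section Modules

variable (F : Type*) [Field F] (d : ℕ)

/-- Matrix of `h` on `V_d`: `h.v_n = (d - 2n) v_n`. -/
def matH : Matrix (Fin (d + 1)) (Fin (d + 1)) F :=
  Matrix.diagonal fun n => (d : F) - 2 * (n.val : F)

/-- Matrix of `f` on `V_d`: `f.v_n = (n + 1) v_{n+1}` for `n < d` and `f.v_d = 0`. -/
def matF : Matrix (Fin (d + 1)) (Fin (d + 1)) F :=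
  Matrix.of fun m n => if m.val = n.val + 1 then (n.val : F) + 1 else 0

/-- Matrix of `e` on `V_d`: `e.v_n = (d - n + 1) v_{n-1}` for `n ≥ 1` and `e.v_0 = 0`. -/
def matE : Matrix (Fin (d + 1)) (Fin (d + 1)) F :=
  Matrix.of fun m n => if m.val + 1 = n.val then (d : F) - (n.val : F) + 1 else 0

/-- The space with basis `v_0, …, v_d`; `v_n` is the `n`-th standard basis vector. -/
def SlModule : Type _ := Fin (d + 1) → F

instance : AddCommGroup (SlModule F d) := inferInstanceAs (AddCommGroup (Fin (d + 1) → F))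

instance : Module F (SlModule F d) := inferInstanceAs (Module F (Fin (d + 1) → F))

/-- The matrix of an element `M = M₀₁ e + M₁₀ f + M₀₀ h` of `sl₂` on `V_d`. -/
def slMatrix (M : sl (Fin 2) F) : Matrix (Fin (d + 1)) (Fin (d + 1)) F :=
  M.val 0 1 • matE F d + M.val 1 0 • matF F d + M.val 0 0 • matH F d

theorem matH_matE : matH F d * matE F d - matE F d * matH F d = (2 : F) • matE F d := by
  ext m n
  simp only [matH, matE, Matrix.sub_apply, Matrix.diagonal_mul, Matrix.mul_diagonal,
    Matrix.of_apply, Matrix.smul_apply, smul_eq_mul]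
  split_ifs with h
  · rw [← h]; push_cast; ring
  · ring

theorem matH_matF : matH F d * matF F d - matF F d * matH F d = (-2 : F) • matF F d := by
  ext m n
  simp only [matH, matF, Matrix.sub_apply, Matrix.diagonal_mul, Matrix.mul_diagonal,
    Matrix.of_apply, Matrix.smul_apply, smul_eq_mul]
  split_ifs with h
  · rw [h]; push_cast; ring
  · ring

theorem matE_matF_apply (m n : Fin (d + 1)) : (matE F d * matF F d) m n =
    if m = n then ((d : F) - n.val) * (n.val + 1) else 0 := by
  rw [Matrix.mul_apply]
  simp only [matE, matF, Matrix.of_apply]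
  by_cases hm : m.val < d
  · rw [Finset.sum_eq_single (⟨m.val + 1, by omega⟩ : Fin (d + 1))]
    · by_cases h : m = n
      · subst h; simp; left; ring
      · have : m.val ≠ n.val := fun h' => h (Fin.ext h')
        simp [h, this]
    · intro b _ hb
      have : ¬ (m.val + 1 = b.val) := fun h => hb (Fin.ext h.symm)
      simp [this]
    · simp
  · have hmd : m.val = d := by omega
    rw [Finset.sum_eq_zero]
    · split_ifs with h
      · subst h; simp [hmd]
      · rfl
    · intro b _
      have : ¬ (m.val + 1 = b.val) := by omega
      simp [this]

theorem matF_matE_apply (m n : Fin (d + 1)) : (matF F d * matE F d) m n =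
    if m = n then (n.val : F) * ((d : F) - n.val + 1) else 0 := by
  rw [Matrix.mul_apply]
  simp only [matE, matF, Matrix.of_apply]
  by_cases hm : 0 < m.val
  · rw [Finset.sum_eq_single (⟨m.val - 1, by omega⟩ : Fin (d + 1))]
    · have e : m.val - 1 + 1 = m.val := by omega
      have e' : ((m.val - 1 : ℕ) : F) + 1 = (m.val : F) := by exact_mod_cast congrArg _ e
      by_cases h : m = n
      · subst h; simp [e, e']
      · have : m.val ≠ n.val := fun h' => h (Fin.ext h')
        simp [h, this, e]
    · intro b _ hb
      have : ¬ (m.val = b.val + 1) := fun h => hb (Fin.ext (by simp; omega))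
      simp [this]
    · simp
  · have hmd : m.val = 0 := by omega
    rw [Finset.sum_eq_zero]
    · split_ifs with h
      · subst h; simp [hmd]
      · rfl
    · intro b _
      have : ¬ (m.val = b.val + 1) := by omega
      simp [this]

theorem matE_matF : matE F d * matF F d - matF F d * matE F d = matH F d := by
  ext m n
  rw [Matrix.sub_apply, matE_matF_apply, matF_matE_apply]
  simp only [matH, Matrix.diagonal_apply]
  split_ifs with h
  · rw [h]; ring
  · ring

theorem sl_val_one_one (M : sl (Fin 2) F) : M.val 1 1 = -M.val 0 0 := by
  have h : Matrix.trace M.val = 0 := M.property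
  rw [Matrix.trace_fin_two] at h
  linear_combination h

theorem slMatrix_lie (M N : sl (Fin 2) F) : slMatrix F d ⁅M, N⁆ =
    slMatrix F d M * slMatrix F d N - slMatrix F d N * slMatrix F d M := by
  have hHE := matH_matE F d
  have hHF := matH_matF F d
  have hEF := matE_matF F d
  have key : ∀ p q r p' q' r' : F, ∀ A B C : Matrix (Fin (d + 1)) (Fin (d + 1)) F,
      (p • A + q • B + r • C) * (p' • A + q' • B + r' • C)
        - (p' • A + q' • B + r' • C) * (p • A + q • B + r • C)
      = (r * p' - p * r') • (C * A - A * C) + (r * q' - q * r') • (C * B - B * C)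
        + (p * q' - q * p') • (A * B - B * A) := by
    intro p q r p' q' r' A B C
    simp only [add_mul, mul_add, smul_mul_assoc, mul_smul_comm]
    module
  simp only [slMatrix, key, hHE, hHF, hEF, sl_bracket, Matrix.sub_apply, Matrix.mul_apply,
    Fin.sum_univ_two, sl_val_one_one]
  module

/-- The `sl₂`-module `V_d`. -/
instance : LieRingModule (sl (Fin 2) F) (SlModule F d) where
  bracket M v := (slMatrix F d M).mulVec v
  add_lie M N v := by
    have h : slMatrix F d (M + N) = slMatrix F d M + slMatrix F d N := by
      simp only [slMatrix, val_add, Matrix.add_apply]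
      module
    exact (congrArg (fun A => Matrix.mulVec A v) h).trans (Matrix.add_mulVec _ _ _)
  lie_add M v w := Matrix.mulVec_add (slMatrix F d M) v w
  leibniz_lie M N v := by
    have h : ∀ w : Fin (d + 1) → F, (slMatrix F d M).mulVec ((slMatrix F d N).mulVec w) =
        (slMatrix F d ⁅M, N⁆).mulVec w + (slMatrix F d N).mulVec ((slMatrix F d M).mulVec w) := by
      intro w
      rw [slMatrix_lie, Matrix.sub_mulVec, Matrix.mulVec_mulVec, Matrix.mulVec_mulVec,
        sub_add_cancel]
    exact h v

instance : LieModule F (sl (Fin 2) F) (SlModule F d) where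
  smul_lie c M v := by
    have h : slMatrix F d (c • M) = c • slMatrix F d M := by
      simp only [slMatrix, val_smul, Matrix.smul_apply, smul_eq_mul]
      module
    exact (congrArg (fun A => Matrix.mulVec A v) h).trans (Matrix.smul_mulVec _ _ _)
  lie_smul c M v := Matrix.mulVec_smul (slMatrix F d M) c v

variable {F}

/-- The underlying space of the evaluation module `V_d(a)`, which is that of `V_d`. -/
def EvalModule (d : ℕ) (a : F) (_h0 : a ≠ 0) (_h1 : a ≠ 1) : Type _ := SlModule F d

variable (a : F) (h0 : a ≠ 0) (h1 : a ≠ 1)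

instance : AddCommGroup (EvalModule d a h0 h1) := inferInstanceAs (AddCommGroup (SlModule F d))

instance : Module F (EvalModule d a h0 h1) := inferInstanceAs (Module F (SlModule F d))

instance : LieRingModule (sl (Fin 2) F) (EvalModule d a h0 h1) :=
  inferInstanceAs (LieRingModule (sl (Fin 2) F) (SlModule F d))

instance : LieModule F (sl (Fin 2) F) (EvalModule d a h0 h1) :=
  inferInstanceAs (LieModule F (sl (Fin 2) F) (SlModule F d))

/-- The `⊠`-module `V_d(a)`: the pullback of the `sl₂`-module `V_d` along `EV_a`. -/
instance : LieRingModule (Tet F) (EvalModule d a h0 h1) :=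
  LieRingModule.compLieHom (EvalModule d a h0 h1) (EV a h0 h1)

instance : LieModule F (Tet F) (EvalModule d a h0 h1) :=
  LieModule.compLieHom (EvalModule d a h0 h1) (EV a h0 h1)

end Modules

/-! ### Diameter and shape -/

section Shape

variable (F : Type*) [Field F] (V : Type*) [AddCommGroup V] [Module F V]
  [LieRingModule (Tet F) V] [LieModule F (Tet F) V]

/-- `V` is isomorphic to an evaluation module `V_d(a)` with `d ≥ 1` and `a ≠ 0, 1`. -/
def IsEvaluation : Prop :=
  ∃ (d : ℕ) (a : F) (h0 : a ≠ 0) (h1 : a ≠ 1),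
    1 ≤ d ∧ Nonempty (V ≃ₗ⁅F, Tet F⁆ EvalModule d a h0 h1)

/-- The action of the generator `x_{ij}` on `V`. -/
def genAct (i j : Fin 4) (h : i ≠ j) : Module.End F V :=
  LieModule.toEnd F (Tet F) V (tetGen F i j h)

/-- For each generator the set of distinct eigenvalues on `V` is `{d - 2n | 0 ≤ n ≤ d}`. -/
def IsDiameter (d : ℕ) : Prop :=
  ∀ (i j : Fin 4) (h : i ≠ j),
    {c : F | (genAct F V i j h).HasEigenvalue c} = {c : F | ∃ n : ℕ, n ≤ d ∧ c = (d : F) - 2 * n}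

/-- The diameter of `V`: the natural number `d` with `IsDiameter F V d`. There is exactly one when
`V` is a finite-dimensional irreducible module in characteristic `0`; the value is `0` by default
if there is none. -/
def diameter : ℕ := sInf {d : ℕ | IsDiameter F V d}

/-- The `n`-th component of the decomposition `[i, j]` of `V`: the eigenspace of `x_{ij}` for the
eigenvalue `2n - d`, where `d` is the diameter of `V`. -/
def component (i j : Fin 4) (h : i ≠ j) (n : Fin (diameter F V + 1)) : Submodule F V :=
  (genAct F V i j h).eigenspace (2 * (n.val : F) - (diameter F V : F))

/-- The shape of the decomposition `[i, j]` of `V`. -/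
def shape (i j : Fin 4) (h : i ≠ j) : Fin (diameter F V + 1) → ℕ :=
  fun n => Module.finrank F (component F V i j h n)

end Shape

end

end Tetrahedron

/-!
An irreducible module is an evaluation module exactly when one generator has simple spectrum.

The relation `⁅x, y⁆ = 2x + 2y` makes `x + y` raise the eigenvalues of `x` by `2`. Hence `x + y` is
nilpotent, and `exp ((x + y) / 2)` conjugates `x` to `-y` (`exists_isUnit_mul_eq_neg_mul`). Walking
along the edges of the tetrahedron, all generators are conjugate on a finite-dimensional module
(`finrank_eigenspace_genAct_eq`), so the shape does not depend on the edge. Moreover the sum of the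
eigenspaces of a generator over a class of eigenvalues modulo `2` is the same for all generators, so
it is a submodule; on an irreducible module it is everything, and the generators are diagonalizable
with eigenvalues in one class (`eigenCoset_genAct_eq_top`). Together with the theory of primitive
vectors for the `sl₂`-triple carried by a face, this shows that the diameter exists
(`exists_isDiameter`).

On `V_d(a)` the generator `x_{31}` is diagonal with entries `d - 2n`, which gives the shape of an
evaluation module (`shape_eq_one_of_isEvaluation`).

Conversely, let all generators have simple spectrum. The face `123` acts as the equitable basis of
`sl₂` on `V_d` (`exists_basis_toMatrix_eq`). The two triangle relations between `x_{03}` and the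
edges of the face at the vertex `3` say that `x_{03} + x_{31}` commutes with `f` and has weight `-2`,
so it is a multiple of `f` (`exists_eq_smul_toEnd_of_commute`); that is,
`x_{03} = a x_{23} + (a - 1) x_{31}` for some `a`. By rotation `x_{01}` and `x_{02}` are given in the
same way by scalars `b` and `c`, and the triangle relations at the vertex `0` give `a b = a - 1` and
`c a = c - 1` (`mul_eq_sub_one_of_genAct_eq`). Thus `a ≠ 0, 1`, and the action is that of `V_d(a)`.
-/

namespace Tetrahedron

open Module

/-! ### Pairs of endomorphisms with `⁅x, y⁆ = 2x + 2y` -/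

section EquitablePair

variable {F V : Type*} [Field F] [AddCommGroup V] [Module F V] {x y : End F V}

theorem mul_add_pow_of_lie_eq (hxy : ⁅x, y⁆ = (2 : F) • x + (2 : F) • y) (n : ℕ) :
    x * (x + y) ^ n = (x + y) ^ n * x + (2 * n : F) • (x + y) ^ n := by
  have h : x * (x + y) = (x + y) * x + (2 : F) • (x + y) := by
    rw [Ring.lie_def] at hxy
    rw [smul_add, ← hxy]
    noncomm_ring
  induction n with
  | zero => simp
  | succ n ih =>
    rw [pow_succ, ← mul_assoc, ih, add_mul, mul_assoc, h, smul_mul_assoc, mul_add, ← mul_assoc,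
      mul_smul_comm, add_assoc, ← add_smul]
    congr 2
    push_cast
    ring

theorem eigenspace_neg_apply (x : End F V) (μ : F) : (-x).eigenspace μ = x.eigenspace (-μ) := by
  ext v
  simp [neg_eq_iff_eq_neg]

/-- The sum of the eigenspaces of `x` whose eigenvalue differs from `μ` by an even integer. -/
def eigenCoset (x : End F V) (μ : F) : Submodule F V :=
  ⨆ k : ℤ, x.eigenspace (μ + 2 * k)

theorem eigenCoset_neg_apply (x : End F V) (μ : F) : eigenCoset (-x) μ = eigenCoset x (-μ) := by
  unfold eigenCoset
  rw [← (Equiv.neg ℤ).iSup_comp]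
  refine iSup_congr fun k => ?_
  rw [eigenspace_neg_apply]
  congr 1
  simp
  ring

theorem self_mem_eigenCoset {μ : F} {v : V} (hv : v ∈ eigenCoset x μ) :
    x v ∈ eigenCoset x μ := by
  suffices h : eigenCoset x μ ≤ (eigenCoset x μ).comap x from h hv
  refine iSup_le fun k w hw => ?_
  have h : x.eigenspace (μ + 2 * k) ≤ eigenCoset x μ :=
    le_iSup (fun k : ℤ => x.eigenspace (μ + 2 * (k : F))) k
  rw [Submodule.mem_comap, End.mem_eigenspace_iff.1 hw]
  exact Submodule.smul_mem _ _ (h hw)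

/-- If `⁅x, y⁆ = 2x + 2y`, then `x + y` raises eigenvalues of `x` by `2`. -/
theorem add_mem_eigenCoset (hxy : ⁅x, y⁆ = (2 : F) • x + (2 : F) • y) {μ : F} {v : V}
    (hv : v ∈ eigenCoset x μ) : (x + y) v ∈ eigenCoset x μ := by
  suffices h : eigenCoset x μ ≤ (eigenCoset x μ).comap (x + y) from h hv
  refine iSup_le fun k w hw => ?_
  have h : x.eigenspace (μ + 2 * (k + 1 : ℤ)) ≤ eigenCoset x μ :=
    le_iSup (fun k : ℤ => x.eigenspace (μ + 2 * (k : F))) (k + 1)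
  refine h (End.mem_eigenspace_iff.2 ?_)
  have := LinearMap.congr_fun (mul_add_pow_of_lie_eq hxy 1) w
  simp only [pow_one, End.mul_apply, End.mem_eigenspace_iff.1 hw, LinearMap.add_apply,
    LinearMap.smul_apply, map_smul, Nat.cast_one] at this ⊢
  rw [this]
  push_cast
  module

theorem exists_eq_add_two_mul_of_eigenCoset_eq_top {x : End F V} {μ ν : F}
    (h : eigenCoset x μ = ⊤) (hν : x.HasEigenvalue ν) : ∃ k : ℤ, ν = μ + 2 * k := by
  by_contra! hk
  have hle : eigenCoset x μ ≤ ⨆ κ ≠ ν, x.eigenspace κ :=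
    iSup_le fun k => le_iSup₂_of_le (μ + 2 * (k : F)) (hk k).symm le_rfl
  have := x.eigenspaces_iSupIndep ν
  rw [top_le_iff.1 (h.symm.trans_le hle), disjoint_top] at this
  exact hν this

theorem map_eigenspace_of_isUnit {E : End F V} (hE : IsUnit E) (h : y * E = -(E * x)) (μ : F) :
    (x.eigenspace μ).map E = y.eigenspace (-μ) := by
  have hb := (End.isUnit_iff E).1 hE
  ext v
  obtain ⟨w, rfl⟩ := hb.2 v
  have hw : y (E w) = -E (x w) := LinearMap.congr_fun h w
  rw [Submodule.mem_map, End.mem_eigenspace_iff, hw, neg_smul, neg_inj, ← map_smul,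
    hb.1.eq_iff, ← End.mem_eigenspace_iff]
  exact ⟨fun ⟨u, hu, hu'⟩ => hb.1 hu' ▸ hu, fun hw => ⟨w, hw, rfl⟩⟩

variable [CharZero F] [FiniteDimensional F V]

theorem isNilpotent_add_of_lie_eq (hxy : ⁅x, y⁆ = (2 : F) • x + (2 : F) • y) :
    IsNilpotent (x + y) := by
  by_contra hn
  -- Otherwise every power of `x + y` is an eigenvector of `ad x`, with eigenvalue `2n`.
  let φ : End F (End F V) := LinearMap.mulLeft F x - LinearMap.mulRight F x
  refine Set.infinite_of_injective_forall_mem (f := fun n : ℕ => (2 * n : F)) ?_ ?_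
    φ.finite_hasEigenvalue
  · intro m n h
    simpa using h
  · intro n
    refine End.hasEigenvalue_of_hasEigenvector (x := (x + y) ^ n)
      ⟨End.mem_eigenspace_iff.2 ?_, fun h => hn ⟨n, h⟩⟩
    simp [φ, mul_add_pow_of_lie_eq hxy n]

/-- If `⁅x, y⁆ = 2x + 2y`, then the exponential of `(x + y) / 2` conjugates `x` to `-y`. -/
theorem exists_isUnit_mul_eq_neg_mul (hxy : ⁅x, y⁆ = (2 : F) • x + (2 : F) • y) :
    ∃ E : End F V, IsUnit E ∧ y * E = -(E * x) ∧
      ∀ W : Submodule F V, (∀ w ∈ W, (x + y) w ∈ W) → ∀ w ∈ W, E w ∈ W := by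
  obtain ⟨N, hN⟩ := isNilpotent_add_of_lie_eq hxy
  let c : ℕ → F := fun k => ((2 : F) ^ k * (k.factorial : F))⁻¹
  -- `c k` is the coefficient of `tᵏ` in `exp (t / 2)`; the recursion turns the commutator of `x`
  -- with the exponential into multiplication by `x + y`.
  have hc (k : ℕ) : 2 * ((k + 1 : ℕ) : F) * c (k + 1) = c k := by
    have h1 : ((k + 1 : ℕ) : F) ≠ 0 := by exact_mod_cast k.succ_ne_zero
    have h2 : (k.factorial : F) ≠ 0 := by exact_mod_cast k.factorial_ne_zero
    simp only [c, Nat.factorial_succ, Nat.cast_mul]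
    field_simp
    ring
  refine ⟨∑ k ∈ Finset.range (N + 1), c k • (x + y) ^ k, ?_, ?_, ?_⟩
  · rw [Finset.sum_range_succ']
    have h0 : c 0 • (x + y) ^ 0 = (1 : End F V) := by simp [c]
    rw [h0]
    refine IsNilpotent.isUnit_add_one ?_
    have : ∑ k ∈ Finset.range N, c (k + 1) • (x + y) ^ (k + 1) =
        (∑ k ∈ Finset.range N, c (k + 1) • (x + y) ^ k) * (x + y) := by
      simp [Finset.sum_mul, pow_succ]
    rw [this]
    refine Commute.isNilpotent_mul_left ?_ ⟨N, hN⟩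
    exact Commute.sum_left _ _ _ fun k _ => ((Commute.refl _).pow_left k).smul_left _
  · have h1 : x * ∑ k ∈ Finset.range (N + 1), c k • (x + y) ^ k =
        (∑ k ∈ Finset.range (N + 1), c k • (x + y) ^ k) * x +
          ∑ k ∈ Finset.range (N + 1), (2 * k * c k : F) • (x + y) ^ k := by
      rw [Finset.mul_sum, Finset.sum_mul, ← Finset.sum_add_distrib]
      refine Finset.sum_congr rfl fun k _ => ?_
      rw [mul_smul_comm, mul_add_pow_of_lie_eq hxy, smul_add, smul_smul, smul_mul_assoc,
        mul_comm (c k)]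
    have h2 : ∑ k ∈ Finset.range (N + 1), (2 * k * c k : F) • (x + y) ^ k =
        (x + y) * ∑ k ∈ Finset.range (N + 1), c k • (x + y) ^ k := by
      rw [Finset.sum_range_succ', Finset.sum_range_succ _ N, hN]
      simp only [hc, smul_zero, add_zero, Finset.mul_sum, mul_smul_comm, ← pow_succ']
      simp
    rw [h2, add_mul] at h1
    exact eq_neg_of_add_eq_zero_right (left_eq_add.1 (h1.trans (by abel)))
  · intro W hW w hw
    rw [LinearMap.sum_apply]
    refine W.sum_mem fun k _ => ?_
    rw [LinearMap.smul_apply]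
    refine W.smul_mem _ ?_
    clear * - hW hw
    induction k with
    | zero => simpa using hw
    | succ k ih => rw [pow_succ', End.mul_apply]; exact hW _ ih

theorem finrank_eigenspace_eq_neg (hxy : ⁅x, y⁆ = (2 : F) • x + (2 : F) • y) (μ : F) :
    finrank F (x.eigenspace μ) = finrank F (y.eigenspace (-μ)) := by
  obtain ⟨E, hE, h, -⟩ := exists_isUnit_mul_eq_neg_mul hxy
  rw [← map_eigenspace_of_isUnit hE h]
  exact (Submodule.equivMapOfInjective E ((End.isUnit_iff E).1 hE).1 _).finrank_eq

theorem eigenCoset_neg_le (hxy : ⁅x, y⁆ = (2 : F) • x + (2 : F) • y) (μ : F) :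
    eigenCoset (-y) μ ≤ eigenCoset x μ := by
  obtain ⟨E, hE, h, hW⟩ := exists_isUnit_mul_eq_neg_mul hxy
  refine iSup_le fun k => ?_
  rw [eigenspace_neg_apply, ← map_eigenspace_of_isUnit hE h, Submodule.map_le_iff_le_comap]
  intro w hw
  exact hW _ (fun w => add_mem_eigenCoset hxy) w
    (le_iSup (fun k : ℤ => x.eigenspace (μ + 2 * (k : F))) k hw)

theorem eigenCoset_neg_eq (hxy : ⁅x, y⁆ = (2 : F) • x + (2 : F) • y) (μ : F) :
    eigenCoset (-y) μ = eigenCoset x μ := by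
  refine (eigenCoset_neg_le hxy μ).antisymm ?_
  have h : ⁅-y, -x⁆ = (2 : F) • (-y) + (2 : F) • (-x) := by
    rw [Ring.lie_def] at hxy ⊢
    rw [neg_mul_neg, neg_mul_neg, ← neg_sub, hxy]
    module
  simpa using eigenCoset_neg_le h μ

end EquitablePair

/-! ### The presentation of the tetrahedron algebra -/

section Presentation

variable (F : Type*) [Field F]

theorem tetGen_skew (i j : Fin 4) (h : i ≠ j) : tetGen F j i h.symm = -tetGen F i j h := by
  have := (LieSubmodule.Quotient.mk_eq_zero (N := relIdeal F)).2
    (LieSubmodule.subset_lieSpan (IsRelator.skew i j h))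
  exact eq_neg_of_add_eq_zero_right this

theorem lie_tetGen (i j k : Fin 4) (hij : i ≠ j) (hjk : j ≠ k) (hik : i ≠ k) :
    ⁅tetGen F i j hij, tetGen F j k hjk⁆ =
      (2 : F) • tetGen F i j hij + (2 : F) • tetGen F j k hjk := by
  have := (LieSubmodule.Quotient.mk_eq_zero (N := relIdeal F)).2
    (LieSubmodule.subset_lieSpan (IsRelator.triangle i j k hij hjk hik))
  exact sub_eq_zero.1 this

variable {F}

/-- The generators `x_{ij}` generate `⊠` as a Lie algebra. -/
@[elab_as_elim]
theorem tet_induction {p : Tet F → Prop} (gen : ∀ i j h, p (tetGen F i j h))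
    (add : ∀ u v, p u → p v → p (u + v)) (smul : ∀ (c : F) u, p u → p (c • u))
    (lie : ∀ u v, p u → p v → p ⁅u, v⁆) (u : Tet F) : p u := by
  let S : LieSubalgebra F (Tet F) :=
    { carrier := {u | p u}
      add_mem' := fun {u v} => add u v
      zero_mem' := by
        have := smul 0 _ (gen 0 1 (by decide))
        rwa [zero_smul] at this
      smul_mem' := smul
      lie_mem' := fun {u v} => lie u v }
  let g : FreeLieAlgebra F Edge →ₗ⁅F⁆ S :=
    FreeLieAlgebra.lift F fun q => ⟨tetGen F q.1.1 q.1.2 q.2, gen _ _ _⟩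
  let π : FreeLieAlgebra F Edge →ₗ⁅F⁆ Tet F :=
    { (LieSubmodule.Quotient.mk' (relIdeal F) : FreeLieAlgebra F Edge →ₗ[F] Tet F) with
      map_lie' := rfl }
  have h : S.incl.comp g = π := by
    refine FreeLieAlgebra.hom_ext fun q => ?_
    rw [LieHom.comp_apply, FreeLieAlgebra.lift_of_apply]
    rfl
  obtain ⟨a, rfl⟩ := LieSubmodule.Quotient.surjective_mk' _ u
  exact (LieHom.congr_fun h a) ▸ (g a).2

theorem EV_tetGen (a : F) (h0 : a ≠ 0) (h1 : a ≠ 1) (i j : Fin 4) (h : i ≠ j) :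
    EV a h0 h1 (tetGen F i j h) = evGen a i j :=
  FreeLieAlgebra.lift_of_apply _ (⟨(i, j), h⟩ : Edge)

end Presentation

/-! ### Independence of the edge -/

/-- Data attached to the oriented edges of the tetrahedron is constant if it is the same at
`(i, j)` and `(k, j)`, and if reversing the edge amounts to a twist `σ` of a parameter. -/
theorem edge_data_const {M α : Type*} (σ : M → M) (g : (i j : Fin 4) → i ≠ j → M → α)
    (hA : ∀ i j k (hij : i ≠ j) (hjk : j ≠ k), i ≠ k → ∀ μ, g i j hij μ = g k j hjk.symm μ)
    (hB : ∀ i j (hij : i ≠ j) μ, g j i hij.symm μ = g i j hij (σ μ))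
    (i j k l : Fin 4) (hij : i ≠ j) (hkl : k ≠ l) (μ : M) : g i j hij μ = g k l hkl μ := by
  have hS (i j : Fin 4) (hij : i ≠ j) (μ : M) : g i j hij μ = g j i hij.symm μ := by
    obtain ⟨k, hik, hjk⟩ : ∃ k : Fin 4, i ≠ k ∧ j ≠ k := by
      clear hA hB; revert i j; decide
    -- The path `ij, kj, jk, ik, ki, ji` reverses twice, so the twists cancel.
    rw [hA i j k hij hjk hik, hB j k hjk, hA j k i hjk hik.symm hij.symm, ← hB i k hik,
      hA k i j hik.symm hij hjk.symm]
  have hA' (i k j : Fin 4) (hij : i ≠ j) (hkj : k ≠ j) : g i j hij μ = g k j hkj μ := by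
    by_cases hik : i = k
    · subst hik; rfl
    · exact hA i j k hij hkj.symm hik μ
  by_cases hjl : j = l
  · subst hjl; exact hA' i k j hij hkl
  · rw [hA' i l j hij (Ne.symm hjl), hS l j, hA' j k l hjl hkl]

section Action

variable (F : Type*) [Field F] (V : Type*) [AddCommGroup V] [Module F V]
  [LieRingModule (Tet F) V] [LieModule F (Tet F) V]

theorem genAct_skew (i j : Fin 4) (h : i ≠ j) : genAct F V j i h.symm = -genAct F V i j h := by
  rw [genAct, tetGen_skew, map_neg, genAct]

theorem lie_genAct (i j k : Fin 4) (hij : i ≠ j) (hjk : j ≠ k) (hik : i ≠ k) :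
    ⁅genAct F V i j hij, genAct F V j k hjk⁆ =
      (2 : F) • genAct F V i j hij + (2 : F) • genAct F V j k hjk := by
  simp only [genAct, ← LieHom.map_lie, lie_tetGen F i j k hij hjk hik, map_add, map_smul]

variable [CharZero F]

variable {F V} in
theorem genAct_ne_zero (hV : ¬ LieModule.IsTrivial (Tet F) V) (i j : Fin 4) (hij : i ≠ j) :
    genAct F V i j hij ≠ 0 := by
  intro h0
  have h2 : (2 : F) ≠ 0 := two_ne_zero
  have key (k l : Fin 4) (hkl : k ≠ l) : genAct F V k l hkl = 0 := by
    have himp : ∀ i j k (hij : i ≠ j) (hjk : j ≠ k), i ≠ k →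
        genAct F V i j hij = 0 → genAct F V k j hjk.symm = 0 := by
      intro i j k hij hjk hik h
      have := lie_genAct F V i j k hij hjk hik
      rw [h, Ring.lie_def, zero_mul, mul_zero, sub_zero, smul_zero, zero_add, eq_comm,
        smul_eq_zero] at this
      rw [genAct_skew F V j k hjk, this.resolve_left h2, neg_zero]
    have := edge_data_const (M := Unit) id (fun i j h _ => genAct F V i j h = 0)
      (fun i j k hij hjk hik _ => propext ⟨himp i j k hij hjk hik,
        himp k j i hjk.symm hij.symm hik.symm⟩)
      (fun i j hij _ => by simp [genAct_skew F V i j hij]) i j k l hij hkl ()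
    exact this ▸ h0
  refine hV ⟨fun u => ?_⟩
  induction u using tet_induction with
  | gen i j h => exact fun v => LinearMap.congr_fun (key i j h) v
  | add u v hu hv => intro w; rw [add_lie, hu, hv, add_zero]
  | smul c u hu => intro w; rw [smul_lie, hu, smul_zero]
  | lie u v hu hv => intro w; rw [lie_lie, hu, hu, hv, sub_zero]

variable [FiniteDimensional F V]

theorem finrank_eigenspace_genAct_eq (i j k l : Fin 4) (hij : i ≠ j) (hkl : k ≠ l) (μ : F) :
    finrank F ((genAct F V i j hij).eigenspace μ) =
      finrank F ((genAct F V k l hkl).eigenspace μ) :=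
  edge_data_const Neg.neg (fun i j h μ => finrank F ((genAct F V i j h).eigenspace μ))
    (fun i j k hij hjk hik μ => by
      rw [finrank_eigenspace_eq_neg (lie_genAct F V i j k hij hjk hik), genAct_skew F V j k hjk,
        eigenspace_neg_apply])
    (fun i j hij μ => by rw [genAct_skew F V i j hij, eigenspace_neg_apply]) i j k l hij hkl μ

theorem eigenCoset_genAct_eq (i j k l : Fin 4) (hij : i ≠ j) (hkl : k ≠ l) (μ : F) :
    eigenCoset (genAct F V i j hij) μ = eigenCoset (genAct F V k l hkl) μ :=
  edge_data_const Neg.neg (fun i j h μ => eigenCoset (genAct F V i j h) μ)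
    (fun i j k hij hjk hik μ => by
      rw [← eigenCoset_neg_eq (lie_genAct F V i j k hij hjk hik), genAct_skew F V j k hjk])
    (fun i j hij μ => by rw [genAct_skew F V i j hij, eigenCoset_neg_apply]) i j k l hij hkl μ

variable {F V}

theorem hasEigenvalue_genAct_iff (i j k l : Fin 4) (hij : i ≠ j) (hkl : k ≠ l) (μ : F) :
    (genAct F V i j hij).HasEigenvalue μ ↔ (genAct F V k l hkl).HasEigenvalue μ := by
  rw [End.hasEigenvalue_iff, End.hasEigenvalue_iff, ne_eq, ne_eq, ← Submodule.finrank_eq_zero,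
    ← Submodule.finrank_eq_zero, finrank_eigenspace_genAct_eq F V i j k l hij hkl]

theorem hasEigenvalue_genAct_neg {i j : Fin 4} {hij : i ≠ j} {μ : F}
    (hμ : (genAct F V i j hij).HasEigenvalue μ) : (genAct F V i j hij).HasEigenvalue (-μ) := by
  rw [hasEigenvalue_genAct_iff i j j i hij hij.symm, genAct_skew F V i j hij,
    End.hasEigenvalue_iff, eigenspace_neg_apply] at hμ
  exact hμ

/-- On an irreducible module every generator is diagonalizable, and its eigenvalues are congruent
modulo `2`: the sum of the eigenspaces in a class modulo `2` is the same for all generators, hence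
a submodule. -/
theorem eigenCoset_genAct_eq_top (hirr : LieModule.IsIrreducible F (Tet F) V) {i j : Fin 4}
    {hij : i ≠ j} {μ : F} (hμ : (genAct F V i j hij).HasEigenvalue μ) :
    eigenCoset (genAct F V i j hij) μ = ⊤ := by
  let W : LieSubmodule F (Tet F) V :=
    { eigenCoset (genAct F V i j hij) μ with
      lie_mem := by
        intro u
        induction u using tet_induction with
        | gen k l hkl =>
          intro v hv
          change v ∈ eigenCoset (genAct F V i j hij) μ at hv
          change genAct F V k l hkl v ∈ eigenCoset (genAct F V i j hij) μ
          rw [eigenCoset_genAct_eq F V i j k l hij hkl] at hv ⊢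
          exact self_mem_eigenCoset hv
        | add u w hu hw =>
          intro v hv; rw [add_lie]; exact Submodule.add_mem _ (hu hv) (hw hv)
        | smul c u hu => intro v hv; rw [smul_lie]; exact Submodule.smul_mem _ c (hu hv)
        | lie u w hu hw =>
          intro v hv; rw [lie_lie]; exact Submodule.sub_mem _ (hu (hw hv)) (hw (hu hv)) }
  have hW : W.toSubmodule = eigenCoset (genAct F V i j hij) μ := rfl
  rcases hirr.eq_bot_or_eq_top W with h | h
  · refine absurd (le_bot_iff.1 (?_ : _ ≤ (⊥ : Submodule F V))) hμ
    rw [h, LieSubmodule.bot_toSubmodule] at hW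
    rw [hW]
    have := le_iSup (fun k : ℤ => (genAct F V i j hij).eigenspace (μ + 2 * (k : F))) 0
    rwa [Int.cast_zero, mul_zero, add_zero] at this
  · rw [← hW, h, LieSubmodule.top_toSubmodule]

end Action

/-! ### The `sl₂`-triple of a face -/

section Sl2

variable {F : Type*} [Field F] [CharZero F] {V : Type*} [AddCommGroup V] [Module F V]
  [LieRingModule (Tet F) V] [LieModule F (Tet F) V]

theorem tetGen_ne_zero (hV : ¬ LieModule.IsTrivial (Tet F) V) (i j : Fin 4) (hij : i ≠ j) :
    tetGen F i j hij ≠ 0 := fun h => genAct_ne_zero hV i j hij (by rw [genAct, h, map_zero])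

/-- Each face of the tetrahedron yields an `sl₂`-triple, in which `x_{ij}, x_{jk}, x_{ki}` is the
equitable basis. -/
theorem isSl2Triple_tetGen {i j k : Fin 4} (hij : i ≠ j) (hjk : j ≠ k) (hki : k ≠ i)
    (h0 : tetGen F k i hki ≠ 0) :
    IsSl2Triple (tetGen F k i hki) ((2⁻¹ : F) • (tetGen F i j hij + tetGen F k i hki))
      (-(2⁻¹ : F) • (tetGen F j k hjk + tetGen F k i hki)) := by
  have h1 := lie_tetGen F i j k hij hjk hki.symm
  have h2 := lie_tetGen F j k i hjk hki hij.symm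
  have h3 := lie_tetGen F k i j hki hij hjk.symm
  have h2' := lie_skew (tetGen F k i hki) (tetGen F j k hjk)
  have h3' := lie_skew (tetGen F i j hij) (tetGen F k i hki)
  rw [h2] at h2'
  rw [h3] at h3'
  refine ⟨h0, ?_, ?_, ?_⟩
  · simp only [lie_smul, smul_lie, add_lie, lie_add, lie_self, h1, ← h2', ← h3']
    module
  · simp only [lie_smul, lie_add, lie_self, h3]
    module
  · simp only [lie_smul, lie_add, lie_self, ← h2']
    module

end Sl2

section PrimitiveVector

variable {F : Type*} [Field F] {V : Type*} [AddCommGroup V] [Module F V]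
  {L : Type*} [LieRing L] [LieAlgebra F L] [LieRingModule L V] [LieModule F L V]
  {h e f : L}

/-- An eigenvector of `h` whose eigenvalue is not followed by another one is primitive. -/
theorem exists_hasPrimitiveVectorWith_of_not_hasEigenvalue (t : IsSl2Triple h e f) {μ : F}
    (hμ : (LieModule.toEnd F L V h).HasEigenvalue μ)
    (hμ' : ¬ (LieModule.toEnd F L V h).HasEigenvalue (μ + 2)) :
    ∃ v : V, t.HasPrimitiveVectorWith v μ := by
  obtain ⟨v, hv, hv0⟩ := hμ.exists_hasEigenvector
  rw [End.mem_eigenspace_iff, LieModule.toEnd_apply_apply] at hv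
  refine ⟨v, hv0, hv, ?_⟩
  by_contra he
  refine hμ' (End.hasEigenvalue_of_hasEigenvector (x := ⁅e, v⁆) ⟨End.mem_eigenspace_iff.2 ?_, he⟩)
  rw [LieModule.toEnd_apply_apply, leibniz_lie, hv, t.lie_h_e_smul F, smul_lie, lie_smul,
    ← add_smul, add_comm]

/-- Raising an eigenvector as far as possible gives a primitive vector. -/
theorem exists_hasPrimitiveVectorWith_of_hasEigenvalue [CharZero F] [FiniteDimensional F V]
    (t : IsSl2Triple h e f) {μ : F}
    (hμ : (LieModule.toEnd F L V h).HasEigenvalue μ) :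
    ∃ (N k : ℕ) (v : V), μ = N - 2 * k ∧ t.HasPrimitiveVectorWith v (N : F) := by
  have hfin : ∃ n : ℕ, ¬ (LieModule.toEnd F L V h).HasEigenvalue (μ + 2 * n) := by
    by_contra! hall
    exact Set.infinite_of_injective_forall_mem (f := fun n : ℕ => μ + 2 * (n : F))
      (fun m n hmn => by simpa using hmn) hall (LieModule.toEnd F L V h).finite_hasEigenvalue
  obtain ⟨k, hk, hk'⟩ := Nat.exists_not_and_succ_of_not_zero_of_exists
    (by simpa using hμ) hfin
  obtain ⟨v, hv⟩ := exists_hasPrimitiveVectorWith_of_not_hasEigenvalue t (not_not.1 hk)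
    (by convert hk' using 2; push_cast; ring)
  obtain ⟨N, hN⟩ := hv.exists_nat
  exact ⟨N, k, v, by rw [← hN]; ring, hN ▸ hv⟩

end PrimitiveVector

/-! ### The diameter -/

section Diameter

variable {F : Type*} [Field F] {V : Type*} [AddCommGroup V] [Module F V]
  [LieRingModule (Tet F) V] [LieModule F (Tet F) V]

theorem IsDiameter.hasEigenvalue_iff {d : ℕ} (hd : IsDiameter F V d) {i j : Fin 4} {hij : i ≠ j}
    {μ : F} : (genAct F V i j hij).HasEigenvalue μ ↔ ∃ n : ℕ, n ≤ d ∧ μ = (d : F) - 2 * n :=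
  Set.ext_iff.1 (hd i j hij) μ

variable [CharZero F]

theorem IsDiameter.le {d d' : ℕ} (hd : IsDiameter F V d) (hd' : IsDiameter F V d') : d ≤ d' := by
  have h : (genAct F V 0 1 (by decide)).HasEigenvalue (d : F) :=
    hd.hasEigenvalue_iff.2 ⟨0, Nat.zero_le _, by simp⟩
  obtain ⟨n, -, hn⟩ := hd'.hasEigenvalue_iff.1 h
  have : d + 2 * n = d' := by exact_mod_cast eq_sub_iff_add_eq.1 hn
  omega

theorem IsDiameter.diameter_eq {d : ℕ} (hd : IsDiameter F V d) : diameter F V = d := by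
  have h : IsDiameter F V (diameter F V) := Nat.sInf_mem (s := {d | IsDiameter F V d}) ⟨d, hd⟩
  exact (h.le hd).antisymm (hd.le h)

variable [FiniteDimensional F V]

theorem isDiameter_of_hasEigenvalue_iff {d : ℕ} {k l : Fin 4} {hkl : k ≠ l}
    (h : ∀ μ : F, (genAct F V k l hkl).HasEigenvalue μ ↔ ∃ n : ℕ, n ≤ d ∧ μ = (d : F) - 2 * n) :
    IsDiameter F V d := by
  intro i j hij
  ext μ
  exact (hasEigenvalue_genAct_iff i j k l hij hkl μ).trans (h μ)

theorem IsDiameter.pos (hirr : LieModule.IsIrreducible F (Tet F) V)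
    (hV : ¬ LieModule.IsTrivial (Tet F) V) {d : ℕ} (hd : IsDiameter F V d) : 1 ≤ d := by
  by_contra h
  obtain rfl : d = 0 := by omega
  have h0 : ∀ μ : F, (genAct F V 0 1 (by decide)).HasEigenvalue μ → μ = 0 := by
    intro μ hμ
    obtain ⟨n, hn, rfl⟩ := hd.hasEigenvalue_iff.1 hμ
    simp [Nat.le_zero.1 hn]
  have htop := eigenCoset_genAct_eq_top hirr
    (hd.hasEigenvalue_iff (i := 0) (j := 1) (hij := by decide) (μ := 0) |>.2 ⟨0, le_rfl, by simp⟩)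
  refine genAct_ne_zero hV 0 1 (by decide) (LinearMap.ext fun v => ?_)
  have hle : eigenCoset (genAct F V 0 1 (by decide)) 0 ≤
      (genAct F V 0 1 (by decide)).eigenspace 0 := by
    refine iSup_le fun k => ?_
    by_cases hk : (genAct F V 0 1 (by decide)).HasEigenvalue (0 + 2 * (k : F))
    · rw [h0 _ hk]
    · rw [End.hasEigenvalue_iff, not_not] at hk
      rw [hk]
      exact bot_le
  rw [htop] at hle
  simpa using End.mem_eigenspace_iff.1 (hle (Submodule.mem_top (x := v)))

theorem exists_isDiameter [IsAlgClosed F] (hirr : LieModule.IsIrreducible F (Tet F) V)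
    (hV : ¬ LieModule.IsTrivial (Tet F) V) : ∃ d, IsDiameter F V d := by
  have : Nontrivial V := LieModule.nontrivial_of_isIrreducible F (Tet F) V
  have h12 : (1 : Fin 4) ≠ 2 := by decide
  have h23 : (2 : Fin 4) ≠ 3 := by decide
  have h31 : (3 : Fin 4) ≠ 1 := by decide
  have t := isSl2Triple_tetGen h12 h23 h31 (tetGen_ne_zero hV 3 1 h31)
  let S : Set ℕ := {n | ∃ v : V, t.HasPrimitiveVectorWith v (n : F)}
  have hprim {μ : F} {v : V} (hv : t.HasPrimitiveVectorWith v μ) :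
      (genAct F V 3 1 h31).HasEigenvalue μ :=
    End.hasEigenvalue_of_hasEigenvector (x := v) ⟨End.mem_eigenspace_iff.2 hv.lie_h, hv.ne_zero⟩
  have hSfin : S.Finite := by
    refine ((genAct F V 3 1 h31).finite_hasEigenvalue.preimage
      (Nat.cast_injective (R := F)).injOn).subset ?_
    rintro n ⟨v, hv⟩
    exact hprim hv
  obtain ⟨μ, hμ⟩ := End.exists_eigenvalue (genAct F V 3 1 h31)
  have hSne : S.Nonempty := by
    obtain ⟨N, k, v, -, hv⟩ := exists_hasPrimitiveVectorWith_of_hasEigenvalue t hμ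
    exact ⟨N, v, hv⟩
  -- The diameter is the largest weight of a primitive vector.
  obtain ⟨d, ⟨v, hv⟩, hmax⟩ := hSfin.exists_maximal hSne
  have hle {ν : F} (hν : (genAct F V 3 1 h31).HasEigenvalue ν) :
      ∃ m : ℕ, ν = (d : F) - 2 * m := by
    obtain ⟨k, hk⟩ := exists_eq_add_two_mul_of_eigenCoset_eq_top
      (eigenCoset_genAct_eq_top hirr (hprim hv)) hν
    obtain ⟨N, l, w, hN, hw⟩ := exists_hasPrimitiveVectorWith_of_hasEigenvalue t hν
    have hNd : N ≤ d := by
      rcases le_total N d with h | h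
      · exact h
      · exact hmax ⟨w, hw⟩ h
    have h1 : (d : ℤ) + 2 * k = N - 2 * l := by
      have := hk.symm.trans hN
      exact_mod_cast this
    refine ⟨(-k).toNat, ?_⟩
    have h2 : (((-k).toNat : ℤ) : F) = ((-k : ℤ) : F) := by
      rw [Int.toNat_of_nonneg (by omega)]
    rw [Int.cast_natCast] at h2
    rw [hk, h2]
    push_cast
    ring
  refine ⟨d, isDiameter_of_hasEigenvalue_iff (hkl := h31) fun ν => ⟨fun hν => ?_, ?_⟩⟩
  · obtain ⟨m, hm⟩ := hle hν
    -- The spectrum is symmetric, so `ν` is bounded below by `-d` as well.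
    obtain ⟨m', hm'⟩ := hle (hasEigenvalue_genAct_neg hν)
    refine ⟨m, ?_, hm⟩
    have : m + m' = d := by
      have h : (2 * (m + m') : F) = 2 * d := by linear_combination hm + hm'
      have := mul_left_cancel₀ two_ne_zero h
      exact_mod_cast this
    omega
  · rintro ⟨n, hn, rfl⟩
    exact End.hasEigenvalue_of_hasEigenvector
      ⟨End.mem_eigenspace_iff.2 (hv.lie_h_pow_toEnd_f n), hv.pow_toEnd_f_ne_zero_of_eq_nat rfl hn⟩

end Diameter

/-! ### The action on evaluation modules -/

section EvalModule

variable {F : Type*} [Field F] (d : ℕ)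

theorem slMatrix_add (M N : sl (Fin 2) F) :
    slMatrix F d (M + N) = slMatrix F d M + slMatrix F d N := by
  simp only [slMatrix, val_add, Matrix.add_apply]
  module

theorem slMatrix_smul (c : F) (M : sl (Fin 2) F) : slMatrix F d (c • M) = c • slMatrix F d M := by
  simp only [slMatrix, val_smul, Matrix.smul_apply, smul_eq_mul]
  module

theorem slMatrix_neg (M : sl (Fin 2) F) : slMatrix F d (-M) = -slMatrix F d M := by
  rw [← neg_one_smul F, slMatrix_smul, neg_one_smul]

theorem slMatrix_sub (M N : sl (Fin 2) F) :
    slMatrix F d (M - N) = slMatrix F d M - slMatrix F d N := by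
  rw [sub_eq_add_neg, slMatrix_add, slMatrix_neg, ← sub_eq_add_neg]

theorem slMatrix_eqX : slMatrix F d (eqX F) = (2 : F) • matE F d - matH F d := by
  simp only [slMatrix, val_eqX]
  simp [sub_eq_add_neg]

theorem slMatrix_eqY : slMatrix F d (eqY F) = -((2 : F) • matF F d) - matH F d := by
  simp only [slMatrix, val_eqY]
  simp [sub_eq_add_neg]

theorem slMatrix_eqZ : slMatrix F d (eqZ F) = matH F d := by
  simp only [slMatrix, val_eqZ]
  simp

variable {d} {a : F} {h0 : a ≠ 0} {h1 : a ≠ 1}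

theorem lie_tetGen_evalModule (i j : Fin 4) (h : i ≠ j) (w : EvalModule d a h0 h1) :
    ⁅tetGen F i j h, w⁆ = (slMatrix F d (evGen a i j)).mulVec w := by
  rw [← EV_tetGen a h0 h1 i j h]
  rfl

theorem lie_tetGen_three_one_apply (h : (3 : Fin 4) ≠ 1) (w : EvalModule d a h0 h1)
    (n : Fin (d + 1)) :
    (⁅tetGen F 3 1 h, w⁆ : EvalModule d a h0 h1) n = ((d : F) - 2 * n.val) * w n := by
  rw [lie_tetGen_evalModule]
  change (slMatrix F d (eqZ F)).mulVec w n = _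
  rw [slMatrix_eqZ]
  exact Matrix.mulVec_diagonal _ _ _

end EvalModule

/-! ### The shape of an evaluation module -/

section ShapeOfEvaluation

variable {F : Type*} [Field F] [CharZero F] {V : Type*} [AddCommGroup V] [Module F V]
  [LieRingModule (Tet F) V] [LieModule F (Tet F) V]

/-- The shape lists the eigenvalues in increasing order, so its `n`-th entry belongs to the eigenvalue
`d - 2(d - n)`. -/
theorem shape_eq_one_iff {d : ℕ} (hd : IsDiameter F V d) (i j : Fin 4) (hij : i ≠ j) :
    (shape F V i j hij = fun _ => 1) ↔
      ∀ n ≤ d, finrank F ((genAct F V i j hij).eigenspace ((d : F) - 2 * n)) = 1 := by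
  have key (n : ℕ) (hn : n ≤ d) : (2 * ((d - n : ℕ) : F) - d) = (d : F) - 2 * n := by
    rw [Nat.cast_sub hn]
    ring
  have hshape (n : ℕ) (hn : n < diameter F V + 1) : shape F V i j hij ⟨n, hn⟩ =
      finrank F ((genAct F V i j hij).eigenspace (2 * (n : F) - d)) := by
    change finrank F ((genAct F V i j hij).eigenspace (2 * (n : F) - (diameter F V : F))) = _
    rw [hd.diameter_eq]
  rw [funext_iff]
  constructor
  · intro h n hn
    have := h ⟨d - n, by rw [hd.diameter_eq]; omega⟩
    rwa [hshape, key n hn] at this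
  · rintro h ⟨n, hn⟩
    have hn' : n ≤ d := Nat.le_of_lt_succ (hd.diameter_eq ▸ hn)
    have := h (d - n) (by omega)
    rwa [← key _ (Nat.sub_le d n), Nat.sub_sub_self hn', ← hshape n hn] at this

variable [FiniteDimensional F V]

theorem shape_eq_one_of_isEvaluation (hV : IsEvaluation F V) (i j : Fin 4) (hij : i ≠ j) :
    shape F V i j hij = fun _ => 1 := by
  obtain ⟨d, a, h0, h1, -, ⟨φ⟩⟩ := hV
  have h31 : (3 : Fin 4) ≠ 1 := by decide
  have hφ (v : V) (n : Fin (d + 1)) :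
      φ (genAct F V 3 1 h31 v) n = ((d : F) - 2 * n.val) * φ v n := by
    rw [← lie_tetGen_three_one_apply h31]
    exact congrFun (φ.toLieModuleHom.map_lie (tetGen F 3 1 h31) v) n
  have hcoord {v w : V} (h : ∀ n, φ v n = φ w n) : v = w := φ.injective (funext h)
  have hsmul (c : F) (v : V) (n : Fin (d + 1)) : φ (c • v) n = c * φ v n :=
    congrFun (φ.toLieModuleHom.map_smul c v) n
  have hzero (n : Fin (d + 1)) : φ (0 : V) n = 0 := congrFun (φ.toLieModuleHom.map_zero) n
  have hinj {m n : Fin (d + 1)} (h : (d : F) - 2 * m.val = (d : F) - 2 * n.val) : m = n := by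
    simpa [Fin.ext_iff] using h
  let b (n : Fin (d + 1)) : V := φ.symm (Pi.single n (1 : F) : Fin (d + 1) → F)
  have hb (n m : Fin (d + 1)) : φ (b n) m = (Pi.single n (1 : F) : Fin (d + 1) → F) m :=
    congrFun (φ.apply_symm_apply _) m
  have hbv (n : Fin (d + 1)) :
      (genAct F V 3 1 h31).HasEigenvector ((d : F) - 2 * n.val) (b n) := by
    refine ⟨End.mem_eigenspace_iff.2 (hcoord fun m => ?_), fun h => ?_⟩
    · rw [hφ, hsmul, hb]
      by_cases hmn : m = n
      · rw [hmn]
      · simp [hmn]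
    · have := hb n n
      rw [h, hzero, Pi.single_eq_same] at this
      exact zero_ne_one this
  have hd : IsDiameter F V d := by
    refine isDiameter_of_hasEigenvalue_iff (hkl := h31) fun μ => ⟨fun hμ => ?_, ?_⟩
    · obtain ⟨v, hv, hv0⟩ := hμ.exists_hasEigenvector
      obtain ⟨n, hn⟩ : ∃ n, φ v n ≠ 0 := by
        by_contra! h
        exact hv0 (hcoord fun n => (h n).trans (hzero n).symm)
      have := hφ v n
      rw [End.mem_eigenspace_iff.1 hv, hsmul] at this
      exact ⟨n, Nat.le_of_lt_succ n.2, mul_right_cancel₀ hn this⟩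
    · rintro ⟨n, hn, rfl⟩
      exact End.hasEigenvalue_of_hasEigenvector (hbv ⟨n, Nat.lt_succ_of_le hn⟩)
  refine (shape_eq_one_iff hd i j hij).2 fun n hn => ?_
  rw [finrank_eigenspace_genAct_eq F V i j 3 1 hij h31]
  let n' : Fin (d + 1) := ⟨n, Nat.lt_succ_of_le hn⟩
  refine finrank_eq_one ⟨b n', (hbv n').1⟩ (fun h => (hbv n').2 (congrArg Subtype.val h)) ?_
  rintro ⟨w, hw⟩
  refine ⟨φ w n', Subtype.ext (hcoord fun m => ?_)⟩
  change φ (φ w n' • b n') m = φ w m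
  rw [hsmul, hb]
  by_cases hm : m = n'
  · simp [hm]
  · have := hφ w m
    rw [End.mem_eigenspace_iff.1 hw, hsmul] at this
    have hm0 : φ w m = 0 := by
      by_contra hne
      exact hm (hinj (mul_right_cancel₀ hne this).symm)
    rw [hm0, Pi.single_eq_of_ne hm, mul_zero]

end ShapeOfEvaluation

/-! ### Modules of an `sl₂`-triple with simple spectrum -/

section SimpleSpectrum

variable {F : Type*} [Field F] [CharZero F] {V : Type*} [AddCommGroup V] [Module F V]
  {L : Type*} [LieRing L] [LieAlgebra F L] [LieRingModule L V] [LieModule F L V]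
  {h e f : L} {d : ℕ}

/-- If `h` has simple spectrum `d, d - 2, …, -d`, then the module is a single `f`-string. -/
theorem exists_primitive_span_eq_top (t : IsSl2Triple h e f)
    (hS : ∀ μ : F, (LieModule.toEnd F L V h).HasEigenvalue μ ↔
      ∃ n : ℕ, n ≤ d ∧ μ = (d : F) - 2 * n)
    (hone : ∀ n ≤ d, finrank F ((LieModule.toEnd F L V h).eigenspace ((d : F) - 2 * n)) = 1)
    (htop : eigenCoset (LieModule.toEnd F L V h) (d : F) = ⊤) :
    ∃ v : V, t.HasPrimitiveVectorWith v (d : F) ∧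
      Submodule.span F (Set.range fun n : Fin (d + 1) => (LieModule.toEnd F L V f ^ n.val) v)
        = ⊤ := by
  have hd2 : ¬ (LieModule.toEnd F L V h).HasEigenvalue ((d : F) + 2) := by
    rw [hS]
    rintro ⟨n, -, hn⟩
    have h1 : (2 + 2 * n : F) = 0 := by linear_combination hn
    have h2 : 2 + 2 * n = 0 := by exact_mod_cast h1
    omega
  obtain ⟨v, hv⟩ := exists_hasPrimitiveVectorWith_of_not_hasEigenvalue t
    ((hS d).2 ⟨0, Nat.zero_le _, by simp⟩) hd2
  refine ⟨v, hv, top_le_iff.1 (htop ▸ iSup_le fun k => ?_)⟩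
  by_cases hk : (LieModule.toEnd F L V h).HasEigenvalue ((d : F) + 2 * (k : F))
  · obtain ⟨n, hn, hkn⟩ := (hS _).1 hk
    rw [hkn]
    intro w hw
    have hne := hv.pow_toEnd_f_ne_zero_of_eq_nat rfl hn
    obtain ⟨c, hc⟩ := (finrank_eq_one_iff_of_nonzero'
      (⟨_, End.mem_eigenspace_iff.2 (hv.lie_h_pow_toEnd_f n)⟩ :
        (LieModule.toEnd F L V h).eigenspace ((d : F) - 2 * n))
      (fun h0 => hne (congrArg Subtype.val h0))).1 (hone n hn) ⟨w, hw⟩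
    rw [← show c • _ = w from congrArg Subtype.val hc]
    exact Submodule.smul_mem _ c (Submodule.subset_span ⟨⟨n, Nat.lt_succ_of_le hn⟩, rfl⟩)
  · rw [End.hasEigenvalue_iff, not_not] at hk
    rw [hk]
    exact bot_le

/-- On a module with simple spectrum, the endomorphisms of weight `-2` that commute with `f` are the
multiples of `f`: such an endomorphism is determined by its value at a primitive vector, and this
value lies in a one-dimensional eigenspace that contains the image of the vector under `f`. -/
theorem exists_eq_smul_toEnd_of_commute (t : IsSl2Triple h e f) (hd : 1 ≤ d)
    (hS : ∀ μ : F, (LieModule.toEnd F L V h).HasEigenvalue μ ↔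
      ∃ n : ℕ, n ≤ d ∧ μ = (d : F) - 2 * n)
    (hone : ∀ n ≤ d, finrank F ((LieModule.toEnd F L V h).eigenspace ((d : F) - 2 * n)) = 1)
    (htop : eigenCoset (LieModule.toEnd F L V h) (d : F) = ⊤)
    {X : End F V} (hXf : Commute X (LieModule.toEnd F L V f))
    (hXh : LieModule.toEnd F L V h * X - X * LieModule.toEnd F L V h = (-2 : F) • X) :
    ∃ c : F, X = c • LieModule.toEnd F L V f := by
  obtain ⟨v, hv, hspan⟩ := exists_primitive_span_eq_top t hS hone htop
  have hXv : X v ∈ (LieModule.toEnd F L V h).eigenspace ((d : F) - 2 * (1 : ℕ)) := by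
    have := LinearMap.congr_fun hXh v
    simp only [LinearMap.sub_apply, End.mul_apply, LinearMap.smul_apply] at this
    rw [LieModule.toEnd_apply_apply F L V h v, hv.lie_h, map_smul, sub_eq_iff_eq_add] at this
    rw [End.mem_eigenspace_iff, this]
    push_cast
    module
  have hne := hv.pow_toEnd_f_ne_zero_of_eq_nat rfl hd
  obtain ⟨c, hc⟩ := (finrank_eq_one_iff_of_nonzero'
    (⟨_, End.mem_eigenspace_iff.2 (hv.lie_h_pow_toEnd_f 1)⟩ :
      (LieModule.toEnd F L V h).eigenspace ((d : F) - 2 * (1 : ℕ)))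
    (fun h0 => hne (congrArg Subtype.val h0))).1 (hone 1 hd) ⟨X v, hXv⟩
  replace hc : c • (LieModule.toEnd F L V f ^ 1) v = X v := congrArg Subtype.val hc
  rw [pow_one] at hc
  refine ⟨c, LinearMap.ext_on_range hspan fun n => ?_⟩
  rw [← End.mul_apply, (hXf.pow_right n.val).eq, End.mul_apply, ← hc, map_smul, ← End.mul_apply,
    ← pow_succ, LinearMap.smul_apply, ← End.mul_apply, ← pow_succ']

/-- The coordinates of `V` relative to the vectors `fⁿv / n!`, for a primitive vector `v`. -/
theorem exists_basis_toMatrix_eq [FiniteDimensional F V] (t : IsSl2Triple h e f)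
    (hS : ∀ μ : F, (LieModule.toEnd F L V h).HasEigenvalue μ ↔
      ∃ n : ℕ, n ≤ d ∧ μ = (d : F) - 2 * n)
    (hone : ∀ n ≤ d, finrank F ((LieModule.toEnd F L V h).eigenspace ((d : F) - 2 * n)) = 1)
    (htop : eigenCoset (LieModule.toEnd F L V h) (d : F) = ⊤) :
    ∃ b : Basis (Fin (d + 1)) F V,
      LinearMap.toMatrix b b (LieModule.toEnd F L V h) = matH F d ∧
      LinearMap.toMatrix b b (LieModule.toEnd F L V e) = matE F d ∧
      LinearMap.toMatrix b b (LieModule.toEnd F L V f) = matF F d := by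
  obtain ⟨v, hv, hspan⟩ := exists_primitive_span_eq_top t hS hone htop
  let B (n : ℕ) : V := (n.factorial : F)⁻¹ • (LieModule.toEnd F L V f ^ n) v
  have hfac (n : ℕ) : (n.factorial : F) ≠ 0 := by exact_mod_cast n.factorial_ne_zero
  have hsucc (n : ℕ) : (n : F) + 1 ≠ 0 := by exact_mod_cast n.succ_ne_zero
  have hBh (n : ℕ) : ⁅h, B n⁆ = ((d : F) - 2 * n) • B n := by
    rw [lie_smul, hv.lie_h_pow_toEnd_f, smul_comm]
  have hBf (n : ℕ) : ⁅f, B n⁆ = ((n : F) + 1) • B (n + 1) := by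
    simp only [B]
    rw [lie_smul, hv.lie_f_pow_toEnd_f, smul_smul, Nat.factorial_succ]
    congr 1
    have := hfac n
    have := hsucc n
    push_cast
    field_simp
  have hBe (n : ℕ) : ⁅e, B (n + 1)⁆ = ((d : F) - n) • B n := by
    simp only [B]
    rw [lie_smul, hv.lie_e_pow_succ_toEnd_f, smul_smul, smul_smul, Nat.factorial_succ]
    congr 1
    have := hfac n
    have := hsucc n
    push_cast
    field_simp
  have hB0 : ⁅e, B 0⁆ = 0 := by simp [B, hv.lie_e]
  have hBd : B (d + 1) = 0 := by
    simp only [B]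
    rw [hv.pow_toEnd_f_eq_zero_of_eq_nat rfl, smul_zero]
  have hli : LinearIndependent F fun n : Fin (d + 1) => B n := by
    refine End.eigenvectors_linearIndependent' (LieModule.toEnd F L V h)
      (fun n : Fin (d + 1) => (d : F) - 2 * n.val) (fun m n hmn => by
        simpa [Fin.ext_iff] using hmn) _ fun n => ⟨End.mem_eigenspace_iff.2 (hBh n), ?_⟩
    exact smul_ne_zero (inv_ne_zero (hfac _))
      (hv.pow_toEnd_f_ne_zero_of_eq_nat rfl (Nat.le_of_lt_succ n.2))
  have hsp : ⊤ ≤ Submodule.span F (Set.range fun n : Fin (d + 1) => B n) := by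
    rw [← hspan, Submodule.span_le]
    rintro _ ⟨n, rfl⟩
    have : (LieModule.toEnd F L V f ^ n.val) v = (n.val.factorial : F) • B n := by
      simp only [B]
      rw [smul_inv_smul₀ (hfac _)]
    change (LieModule.toEnd F L V f ^ n.val) v ∈ _
    rw [this]
    exact Submodule.smul_mem _ _ (Submodule.subset_span ⟨n, rfl⟩)
  let b : Basis (Fin (d + 1)) F V := Basis.mk hli hsp
  have hb (n : Fin (d + 1)) : b n = B n := Basis.mk_apply hli hsp n
  refine ⟨b, ?_, ?_, ?_⟩
  · ext m n
    rw [LinearMap.toMatrix_apply, LieModule.toEnd_apply_apply, hb, hBh, ← hb, map_smul,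
      Basis.repr_self, matH, Matrix.diagonal_apply]
    by_cases hmn : m = n
    · simp [hmn]
    · simp [hmn, Finsupp.single_eq_of_ne hmn]
  · ext m n
    rw [LinearMap.toMatrix_apply, LieModule.toEnd_apply_apply, hb, matE, Matrix.of_apply]
    obtain ⟨n, hn⟩ := n
    cases n with
    | zero => simp [hB0]
    | succ n =>
      have hn' : n < d + 1 := by omega
      rw [hBe, ← hb ⟨n, hn'⟩, map_smul, Basis.repr_self]
      by_cases hmn : m = ⟨n, hn'⟩
      · subst hmn
        simp
        ring
      · have : m.val ≠ n := fun h => hmn (Fin.ext h)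
        simp [Finsupp.single_eq_of_ne hmn, this]
  · ext m n
    rw [LinearMap.toMatrix_apply, LieModule.toEnd_apply_apply, hb, matF, Matrix.of_apply, hBf]
    obtain ⟨n, hn⟩ := n
    rcases Nat.lt_or_ge (n + 1) (d + 1) with hlt | hge
    · rw [← hb ⟨n + 1, hlt⟩, map_smul, Basis.repr_self]
      by_cases hmn : m = ⟨n + 1, hlt⟩
      · subst hmn
        simp
      · have : m.val ≠ n + 1 := fun h => hmn (Fin.ext h)
        simp [Finsupp.single_eq_of_ne hmn, this]
    · obtain rfl : n = d := by omega
      have : m.val ≠ n + 1 := by omega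
      simp [hBd, this]

end SimpleSpectrum

/-- A property of oriented edges that does not depend on the orientation need only be checked on
one orientation of each edge. -/
theorem edge_cases {P : (i j : Fin 4) → i ≠ j → Prop} (hP : ∀ i j h, P i j h → P j i h.symm)
    (h01 : P 0 1 (by decide)) (h02 : P 0 2 (by decide)) (h03 : P 0 3 (by decide))
    (h12 : P 1 2 (by decide)) (h23 : P 2 3 (by decide)) (h31 : P 3 1 (by decide))
    (i j : Fin 4) (h : i ≠ j) : P i j h := by
  fin_cases i <;> fin_cases j <;>
    first
      | exact absurd rfl h
      | assumption
      | exact hP _ _ _ (by assumption)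

/-! ### Reconstruction of the evaluation parameter -/

section Apex

variable {F : Type*} [Field F] [CharZero F] {V : Type*} [AddCommGroup V] [Module F V]
  [LieRingModule (Tet F) V] [LieModule F (Tet F) V]

/-- The relations at the vertex `k` force an edge leaving the face `ijk` from `k` into the span of
the two edges of the face at `k`. -/
theorem exists_genAct_eq_of_face [FiniteDimensional F V]
    (hirr : LieModule.IsIrreducible F (Tet F) V)
    (hV : ¬ LieModule.IsTrivial (Tet F) V) {d : ℕ} (hd : IsDiameter F V d)
    (hone : ∀ (i j : Fin 4) (hij : i ≠ j), ∀ n ≤ d,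
      finrank F ((genAct F V i j hij).eigenspace ((d : F) - 2 * n)) = 1)
    (i j k l : Fin 4) (hij : i ≠ j) (hjk : j ≠ k) (hki : k ≠ i) (hli : l ≠ i) (hlj : l ≠ j)
    (hlk : l ≠ k) :
    ∃ a : F, genAct F V l k hlk = a • genAct F V j k hjk + (a - 1) • genAct F V k i hki := by
  have t := isSl2Triple_tetGen hij hjk hki (tetGen_ne_zero hV k i hki)
  have h1 := lie_genAct F V l k i hlk hki hli
  have h2 := lie_genAct F V l k j hlk hjk.symm hlj
  have h3 := lie_genAct F V j k i hjk hki hij.symm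
  rw [genAct_skew F V j k hjk] at h2
  have hf : LieModule.toEnd F (Tet F) V (-(2⁻¹ : F) • (tetGen F j k hjk + tetGen F k i hki)) =
      -(2⁻¹ : F) • (genAct F V j k hjk + genAct F V k i hki) := by
    rw [map_smul, map_add]
    rfl
  have hS (μ : F) := hd.hasEigenvalue_iff (hij := hki) (μ := μ)
  have htop : eigenCoset (genAct F V k i hki) (d : F) = ⊤ :=
    eigenCoset_genAct_eq_top hirr ((hS d).2 ⟨0, Nat.zero_le _, by simp⟩)
  obtain ⟨c, hc⟩ := exists_eq_smul_toEnd_of_commute t (hd.pos hirr hV) hS (hone k i hki) htop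
    (X := genAct F V l k hlk + genAct F V k i hki) (by
      rw [hf]
      refine Commute.smul_right ?_ _
      generalize genAct F V l k hlk = A at *
      generalize genAct F V j k hjk = B at *
      generalize genAct F V k i hki = C at *
      rw [Ring.lie_def] at h1 h2 h3
      have : (A + C) * (B + C) - (B + C) * (A + C) =
          -(A * (-B) - (-B) * A) + (A * C - C * A) - (B * C - C * B) := by noncomm_ring
      rw [h1, h2, h3] at this
      exact sub_eq_zero.1 (this.trans (by module))) (by
      change genAct F V k i hki * _ - _ * genAct F V k i hki = _
      generalize genAct F V l k hlk = A at *
      generalize genAct F V k i hki = C at *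
      rw [Ring.lie_def] at h1
      have : C * (A + C) - (A + C) * C = -(A * C - C * A) := by noncomm_ring
      rw [this, h1]
      module)
  rw [hf] at hc
  refine ⟨-(c * 2⁻¹), ?_⟩
  rw [eq_sub_of_add_eq hc]
  module

/-- The relation between two edges at the vertex `l` opposite to the face `ijk` ties together the
coefficients of `x_{lk}` and `x_{li}` along the face: in
`⁅x_{kl}, x_{li}⁆ = 2 x_{kl} + 2 x_{li}` the coefficients of `x_{ij}` and `x_{jk}` agree
identically, so that only a multiple of `x_{ki}` is left. -/
theorem mul_eq_sub_one_of_genAct_eq (hV : ¬ LieModule.IsTrivial (Tet F) V)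
    {i j k l : Fin 4} {hij : i ≠ j} {hjk : j ≠ k} {hki : k ≠ i} {hli : l ≠ i}
    {hlk : l ≠ k} {a b : F}
    (ha : genAct F V l k hlk = a • genAct F V j k hjk + (a - 1) • genAct F V k i hki)
    (hb : genAct F V l i hli = b • genAct F V k i hki + (b - 1) • genAct F V i j hij) :
    a * b = a - 1 := by
  have h1 := lie_genAct F V i j k hij hjk hki.symm
  have h2 := lie_genAct F V j k i hjk hki hij.symm
  have h3 := lie_genAct F V k i j hki hij hjk.symm
  have h4 := lie_genAct F V k l i hlk.symm hli hki
  rw [genAct_skew F V l k hlk, ha, hb] at h4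
  have hne := genAct_ne_zero hV k i hki
  generalize genAct F V i j hij = x at *
  generalize genAct F V j k hjk = y at *
  generalize genAct F V k i hki = z at *
  rw [Ring.lie_def] at h1 h2 h3 h4
  have h5 : -(a • y + (a - 1) • z) * (b • z + (b - 1) • x) -
      (b • z + (b - 1) • x) * -(a • y + (a - 1) • z) =
      (-(a * b)) • (y * z - z * y) + (a * (b - 1)) • (x * y - y * x) -
        ((a - 1) * (b - 1)) • (z * x - x * z) := by
    simp only [neg_mul, mul_neg, add_mul, mul_add, smul_mul_assoc, mul_smul_comm]
    module
  rw [h1, h2, h3, h4] at h5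
  have h6 : (4 * (a * b - (a - 1))) • z = 0 := by
    rw [← sub_eq_zero] at h5
    rw [← h5]
    module
  have h4 : (4 : F) ≠ 0 := by norm_num
  rw [smul_eq_zero, or_iff_left hne, mul_eq_zero, or_iff_right h4] at h6
  exact sub_eq_zero.1 h6

variable [FiniteDimensional F V]

/-- An irreducible module whose generators have simple spectrum is an evaluation module: the face
`123` acts as on `V_d`, and the parameter `a` is read off from the edge `x_{03}`. -/
theorem isEvaluation_of_finrank_eigenspace_eq_one (hirr : LieModule.IsIrreducible F (Tet F) V)
    (hV : ¬ LieModule.IsTrivial (Tet F) V) {d : ℕ} (hd : IsDiameter F V d)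
    (hone : ∀ (i j : Fin 4) (hij : i ≠ j), ∀ n ≤ d,
      finrank F ((genAct F V i j hij).eigenspace ((d : F) - 2 * n)) = 1) :
    IsEvaluation F V := by
  have h12 : (1 : Fin 4) ≠ 2 := by decide
  have h23 : (2 : Fin 4) ≠ 3 := by decide
  have h31 : (3 : Fin 4) ≠ 1 := by decide
  have h01 : (0 : Fin 4) ≠ 1 := by decide
  have h02 : (0 : Fin 4) ≠ 2 := by decide
  have h03 : (0 : Fin 4) ≠ 3 := by decide
  -- Each of the three edges at the vertex `0` is determined by one rotation of the face `123`.
  obtain ⟨a, ha⟩ := exists_genAct_eq_of_face hirr hV hd hone 1 2 3 0 h12 h23 h31 h01 h02 h03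
  obtain ⟨b, hb⟩ := exists_genAct_eq_of_face hirr hV hd hone 2 3 1 0 h23 h31 h12 h02 h03 h01
  obtain ⟨c, hc⟩ := exists_genAct_eq_of_face hirr hV hd hone 3 1 2 0 h31 h12 h23 h03 h01 h02
  have hab : a * b = a - 1 := mul_eq_sub_one_of_genAct_eq hV ha hb
  have hca : c * a = c - 1 := mul_eq_sub_one_of_genAct_eq hV hc ha
  have h0 : a ≠ 0 := by
    rintro rfl
    simp at hab
  have h1 : a ≠ 1 := by
    rintro rfl
    simp [eq_comm (a := c)] at hca
  have h1' : 1 - a ≠ 0 := sub_ne_zero.2 h1.symm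
  have hb' : b = 1 - a⁻¹ := by
    field_simp
    linear_combination hab
  have hc' : c = (1 - a)⁻¹ := by
    field_simp
    linear_combination -hca
  have t := isSl2Triple_tetGen h12 h23 h31 (tetGen_ne_zero hV 3 1 h31)
  have hS (μ : F) := hd.hasEigenvalue_iff (hij := h31) (μ := μ)
  obtain ⟨β, hβh, hβe, hβf⟩ := exists_basis_toMatrix_eq t hS (hone 3 1 h31)
    (eigenCoset_genAct_eq_top hirr ((hS d).2 ⟨0, Nat.zero_le _, by simp⟩))
  let M (i j : Fin 4) (h : i ≠ j) := LinearMap.toMatrix β β (genAct F V i j h)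
  have hskew (i j : Fin 4) (h : i ≠ j) : M j i h.symm = -M i j h := by
    simp only [M, genAct_skew F V i j h, map_neg]
  have hz : M 3 1 h31 = slMatrix F d (eqZ F) := by rw [slMatrix_eqZ, ← hβh]; rfl
  have hx : M 1 2 h12 = slMatrix F d (eqX F) := by
    rw [slMatrix_eqX, ← hβe, ← hβh]
    simp only [M, genAct, map_smul, map_add]
    module
  have hy : M 2 3 h23 = slMatrix F d (eqY F) := by
    rw [slMatrix_eqY, ← hβf, ← hβh]
    simp only [M, genAct, map_smul, map_add]
    module
  have hM (i j : Fin 4) (h : i ≠ j) : M i j h = slMatrix F d (evGen a i j) := by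
    have e03 : M 0 3 h03 = slMatrix F d (evGen a 0 3) := by
      simp only [evGen, slMatrix_add, slMatrix_smul, ← hy, ← hz]
      simp only [M, ha, map_add, map_smul]
    have e01 : M 0 1 h01 = slMatrix F d (evGen a 0 1) := by
      simp only [evGen, slMatrix_sub, slMatrix_smul, ← hx, ← hz]
      simp only [M, hb, map_add, map_smul, hb']
      module
    have e02 : M 0 2 h02 = slMatrix F d (evGen a 0 2) := by
      have hc'' : c - 1 = a * (1 - a)⁻¹ := by rw [← hc', ← hca, mul_comm]
      simp only [evGen, slMatrix_add, slMatrix_smul, ← hx, ← hy]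
      simp only [M, hc, map_add, map_smul, hc'']
      rw [hc']
    have hrev (i j : Fin 4) (h : i ≠ j) (hij : M i j h = slMatrix F d (evGen a i j)) :
        M j i h.symm = slMatrix F d (evGen a j i) := by
      rw [hskew i j h, hij, ← slMatrix_neg, neg_eq_of_add_eq_zero_right (evGen_skew a i j)]
    exact edge_cases (P := fun i j h => M i j h = slMatrix F d (evGen a i j)) hrev
      e01 e02 e03 hx hy hz i j h
  let φ : V ≃ₗ[F] EvalModule d a h0 h1 := β.equivFun
  have hφ (u : Tet F) : ∀ v : V, φ ⁅u, v⁆ = ⁅u, φ v⁆ := by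
    induction u using tet_induction with
    | gen i j h =>
      intro v
      rw [lie_tetGen_evalModule, ← hM i j h]
      exact (LinearMap.toMatrix_mulVec_repr β β (genAct F V i j h) v).symm
    | add u w hu hw => intro v; rw [add_lie, add_lie, map_add, hu, hw]
    | smul c u hu => intro v; rw [smul_lie, smul_lie, map_smul, hu]
    | lie u w hu hw => intro v; rw [lie_lie, lie_lie, map_sub, hu, hw, hw, hu]
  exact ⟨d, a, h0, h1, hd.pos hirr hV, ⟨{ φ with map_lie' := fun {u v} => hφ u v }⟩⟩

end Apex

end Tetrahedron

theorem mainTheorem5 {F : Type*} [Field F] [IsAlgClosed F] [CharZero F]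
    {V : Type*} [AddCommGroup V] [Module F V] [FiniteDimensional F V]
    [LieRingModule (Tetrahedron.Tet F) V] [LieModule F (Tetrahedron.Tet F) V]
    (hirr : LieModule.IsIrreducible F (Tetrahedron.Tet F) V)
    (hnontriv : ¬ LieModule.IsTrivial (Tetrahedron.Tet F) V)
    (i j : Fin 4) (hij : i ≠ j) :
    Tetrahedron.IsEvaluation F V ↔ Tetrahedron.shape F V i j hij = fun _ => 1 := by
  refine ⟨fun h => Tetrahedron.shape_eq_one_of_isEvaluation h i j hij, fun h => ?_⟩
  obtain ⟨d, hd⟩ := Tetrahedron.exists_isDiameter hirr hnontriv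
  refine Tetrahedron.isEvaluation_of_finrank_eigenspace_eq_one hirr hnontriv hd
    fun k l hkl n hn => ?_
  rw [Tetrahedron.finrank_eigenspace_genAct_eq F V k l i j hkl hij]
  exact (Tetrahedron.shape_eq_one_iff hd i j hij).1 h n hn
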